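/- Let $(X,d)$ be a metric space, $D\subset X$, $f:D\to X$ continuous, $m\ge 2$, and let $A=(A_{ij})$ be the $m\times m$ matrix whose first row and first column consist of $1$s (so $A_{11}=1$) and whose other entries are all $0$. Let $V_1,\dots,V_m\subset D$ be disjoint nonempty compact sets on which $f$ is strictly $A$-coupled-expanding, i.e. $f(V_i)\supset\bigcup_{j:\,A_{ij}=1}V_j$ for every $i$ and $d(V_i,V_j)=\inf\{d(x,y):x\in V_i,\,y\in V_j\}>0$ for $i\ne j$. Assume that there are constants $\lambda_1,\dots,\lambda_m>1$ with \[ d(f(x),f(y))=\lambda_i\,d(x,y)\qquad (x,y\in V_i,\ 1\le i\le m). \] Let $\Sigma_m^+(A)=\{(a_0a_1\ldots)\in\{1,\dots,m\}^{\mathbb N}: A_{a_na_{n+1}}=1 \text{ for all } n\ge 0\}$, with the product topology and the shift $\sigma_A$, and put \[ V=\bigcup_{a\in\Sigma_m^+(A)}\ \bigcap_{n\ge 0} f^{-n}(V_{a_n})\subset\bigcup_{i=1}^m V_i . \] Then $f(V)=V$, $V$ is a Cantor set (nonempty, compact, perfect, totally disconnected), and there is a homeomorphism $g:\Sigma_m^+(A)\to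 V$ with $f\circ g=g\circ\sigma_A$ and $g(a)\in V_{a_0}$ for all $a$, so that $f|_V$ is topologically conjugate to $\sigma_A$. Moreover the equation \[ \Big(\frac1{\lambda_1}\Big)^p+\sum_{i=2}^m\Big(\frac1{\lambda_1\lambda_i}\Big)^p=1 \] has exactly one real solution $p_0$, $p_0>0$, and \[ \dim_H V=p_0,\qquad \dim_H \mathrm{LY}_f(V)=2p_0, \] where $\mathrm{LY}_f(V)$ is the set of pairs $(x,y)\in V\times V$ with $\liminf_{n\to\infty}d(f^nx,f^ny)=0$ and $\limsup_{n\to\infty}d(f^nx,f^ny)>0$, and $X\times X$ carries the maximum metric (any of the usual product metrics gives the same dimension). -/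

import Mathlib

open Set Filter Topology

/-- The sequence space `Σ_m^+(A)` of a `0`-`1` matrix `A`, a subspace of `ℕ → Fin m` with the product
of the discrete topologies. -/
def subshiftSpace {m : ℕ} (A : Matrix (Fin m) (Fin m) ℕ) : Set (ℕ → Fin m) :=
  {a | ∀ n, A (a n) (a (n + 1)) = 1}

/-- The one-sided subshift `σ_A`. -/
def subshift {m : ℕ} (A : Matrix (Fin m) (Fin m) ℕ) (a : subshiftSpace A) : subshiftSpace A :=
  ⟨fun n => a.1 (n + 1), fun n => a.2 (n + 1)⟩

/-- The matrix whose first row and first column consist of `1`s, all other entries being `0`. -/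
def crossMatrix (m : ℕ) [NeZero m] : Matrix (Fin m) (Fin m) ℕ :=
  Matrix.of fun i j => if i = 0 ∨ j = 0 then 1 else 0

/-- `f`, regarded as a map from `D ⊆ X` to `X`, is `A`-coupled-expanding in the sets `V i`. -/
structure IsCoupledExpanding {X : Type*} [MetricSpace X] {m : ℕ}
    (A : Matrix (Fin m) (Fin m) ℕ) (f : X → X) (D : Set X) (V : Fin m → Set X) : Prop where
  subset_domain : ∀ i, V i ⊆ D
  nonempty : ∀ i, (V i).Nonempty
  disjoint_interior : ∀ i j, i ≠ j → Disjoint (interior (V i)) (interior (V j))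
  covers : ∀ i, (⋃ j, ⋃ (_ : A i j = 1), V j) ⊆ f '' V i

/-- Strictly `A`-coupled-expanding: moreover distinct `V i`, `V j` are at positive distance. -/
structure IsStrictlyCoupledExpanding {X : Type*} [MetricSpace X] {m : ℕ}
    (A : Matrix (Fin m) (Fin m) ℕ) (f : X → X) (D : Set X) (V : Fin m → Set X) : Prop
    extends IsCoupledExpanding A f D V where
  dist_pos : ∀ i j, i ≠ j → 0 < ⨅ x ∈ V i, ⨅ y ∈ V j, edist x y

/-- The set `⋃_{a ∈ Σ_m^+(A)} ⋂_{n ≥ 0} f^{-n}(V_{a_n})`. -/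
def codedSet {X : Type*} {m : ℕ} (A : Matrix (Fin m) (Fin m) ℕ) (f : X → X)
    (V : Fin m → Set X) : Set X :=
  ⋃ a ∈ subshiftSpace A, ⋂ n : ℕ, f^[n] ⁻¹' V (a n)

/-- A Cantor set: nonempty, compact, perfect and totally disconnected. -/
structure IsCantorSet {X : Type*} [TopologicalSpace X] (C : Set X) : Prop where
  nonempty : C.Nonempty
  isCompact : IsCompact C
  perfect : Perfect C
  isTotallyDisconnected : IsTotallyDisconnected C

/-- `(x, y)` is a Li-Yorke pair for `f`; distances are taken in `[0, ∞]`, so that the lower and upper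
limits always exist. -/
def IsLiYorkePair {X : Type*} [MetricSpace X] (f : X → X) (x y : X) : Prop :=
  liminf (fun n : ℕ => edist (f^[n] x) (f^[n] y)) atTop = 0 ∧
    0 < limsup (fun n : ℕ => edist (f^[n] x) (f^[n] y)) atTop

/-- The set of Li-Yorke pairs of `f` in `S`. -/
def liYorkePairs {X : Type*} [MetricSpace X] (f : X → X) (S : Set X) : Set (X × X) :=
  {z | z.1 ∈ S ∧ z.2 ∈ S ∧ IsLiYorkePair f z.1 z.2}

open scoped ENNReal NNReal

/-! ### The Moran equation -/

/-! Points of the coded set correspond to admissible itineraries. While two itineraries agree, `f`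
multiplies the distance by the known factor `lam`, and once they differ the points are a fixed
distance apart. So the distance of two coded points is, up to constants, the inverse product of the
factors along their common prefix. This gives the conjugacy and reduces the dimensions to counting
words. The critical `p` is the one for which `A` weighted by `lam i ^ (-p)` has a positive
eigenvector `v` with eigenvalue 1; for the cross matrix this is the stated equation
(`sum_crossEigenvector`).

Upper bounds: weighting the pieces by `v`, induction on the scale gives covers by `O(r ^ (-p))` sets
of diameter at most `r` (`exists_isCoverable`). Such counts multiply under products, which Hausdorff
dimension alone need not respect, so the square has dimension at most `2 * p`.

Lower bounds: `v` also defines a Markov chain whose cylinders have probability about (product of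
factors) `^ (-p)`. Reading `t ∈ [0, 1)` as a sequence of digits of this chain gives a map into the
coded set with Hölder inverse. Prescribing digits at a sparse set of times costs a subexponential
factor, so every exponent `s < p` survives (`exists_forced_family`). Two such families are forced to
agree on ever longer windows and to differ at the end of each window. Any member of one and any
member of the other then form a Li-Yorke pair, and the product of the two families, parametrized by
a square, has dimension at least `2 * p`. -/

theorem exists_unique_moran_exponent {ι : Type*} [Fintype ι] (hι : 1 < Fintype.card ι)
    (b : ι → ℝ) (hb0 : ∀ i, 0 < b i) (hb1 : ∀ i, b i < 1) :
    ∃ p₀ : ℝ, 0 < p₀ ∧ ∀ p : ℝ, ∑ i, b i ^ p = 1 ↔ p = p₀ := by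
  have hne : (Finset.univ : Finset ι).Nonempty := by
    rw [← Finset.card_pos, Finset.card_univ]; omega
  have hanti : StrictAnti fun p : ℝ => ∑ i, b i ^ p := fun p q hpq =>
    Finset.sum_lt_sum_of_nonempty hne fun i _ =>
      Real.rpow_lt_rpow_of_exponent_gt (hb0 i) (hb1 i) hpq
  have hcont : Continuous fun p : ℝ => ∑ i, b i ^ p :=
    continuous_finsetSum _ fun i _ => Real.continuous_const_rpow (hb0 i).ne'
  have hlim : Tendsto (fun p : ℝ => ∑ i, b i ^ p) atTop (𝓝 0) := by
    have := tendsto_finsetSum (Finset.univ : Finset ι) fun i _ =>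
      tendsto_rpow_atTop_of_base_lt_one (b i) (by linarith [hb0 i]) (hb1 i)
    simpa using this
  have h0 : (1 : ℝ) < ∑ i, b i ^ (0 : ℝ) := by
    simpa using hι
  obtain ⟨q, hq1, hq0⟩ := ((hlim.eventually (gt_mem_nhds one_pos)).and
    (eventually_ge_atTop (0 : ℝ))).exists
  obtain ⟨p, hp, hp1⟩ := intermediate_value_Icc' hq0 hcont.continuousOn ⟨hq1.le, h0.le⟩
  refine ⟨p, lt_of_le_of_ne hp.1 ?_, fun r => ⟨fun hr => hanti.injective (hr.trans hp1.symm), ?_⟩⟩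
  · rintro rfl
    exact h0.ne' hp1
  · rintro rfl
    exact hp1

/-! ### Bounds for the Hausdorff dimension -/

/-- If the inverse of `ψ` is Hölder continuous with exponent `s`, then `ψ` lowers the Hausdorff
dimension at most by the factor `s`. -/
theorem mul_dimH_le_dimH_image {T Y : Type*} [MetricSpace T] [MetricSpace Y] {ψ : T → Y} {S : Set T}
    {C s : ℝ} (hs : 0 < s)
    (h : ∀ t ∈ S, ∀ t' ∈ S, dist t t' ≤ C * dist (ψ t) (ψ t') ^ s) :
    ENNReal.ofReal s * dimH S ≤ dimH (ψ '' S) := by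
  rcases S.eq_empty_or_nonempty with rfl | ⟨t₀, -⟩
  · simp
  have : Nonempty T := ⟨t₀⟩
  have hinj : InjOn ψ S := fun t ht t' ht' e => by
    have := h t ht t' ht'
    rw [e, dist_self, Real.zero_rpow hs.ne', mul_zero] at this
    exact dist_le_zero.1 this
  have hH : HolderOnWith C.toNNReal s.toNNReal (Function.invFunOn ψ S) (ψ '' S) := by
    rintro _ ⟨t, ht, rfl⟩ _ ⟨t', ht', rfl⟩
    rw [hinj.leftInvOn_invFunOn ht, hinj.leftInvOn_invFunOn ht', edist_dist, edist_dist,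
      Real.coe_toNNReal _ hs.le, ENNReal.ofReal_rpow_of_nonneg dist_nonneg hs.le]
    change _ ≤ ENNReal.ofReal C * _
    rw [← ENNReal.ofReal_mul' (by positivity)]
    exact ENNReal.ofReal_le_ofReal (h t ht t' ht')
  have key := hH.dimH_image_le (Real.toNNReal_pos.2 hs)
  rw [hinj.invFunOn_image subset_rfl] at key
  have hs0 : ENNReal.ofReal s ≠ 0 := by simpa using hs
  rw [mul_comm]
  exact (ENNReal.le_div_iff_mul_le (Or.inl hs0) (Or.inl ENNReal.ofReal_ne_top)).1 key

/-- `K` is covered by at most `N` sets of diameter at most `r`. -/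
def IsCoverable {X : Type*} [MetricSpace X] (K : Set X) (r N : ℝ) : Prop :=
  ∃ 𝒰 : Finset (Set X), (∀ x ∈ K, ∃ U ∈ 𝒰, x ∈ U) ∧
    (∀ U ∈ 𝒰, ∀ x ∈ U, ∀ y ∈ U, dist x y ≤ r) ∧ (𝒰.card : ℝ) ≤ N

theorem IsCoverable.prod {X Y : Type*} [MetricSpace X] [MetricSpace Y] {K : Set X} {L : Set Y}
    {r N M : ℝ} (hK : IsCoverable K r N) (hL : IsCoverable L r M) :
    IsCoverable (K ×ˢ L) r (N * M) := by
  classical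
  obtain ⟨𝒰, hc, hd, hN⟩ := hK
  obtain ⟨𝒲, hc', hd', hM⟩ := hL
  refine ⟨(𝒰 ×ˢ 𝒲).image fun p => p.1 ×ˢ p.2, ?_, ?_, ?_⟩
  · rintro ⟨x, y⟩ ⟨hx, hy⟩
    obtain ⟨U, hU, hxU⟩ := hc x hx
    obtain ⟨W, hW, hyW⟩ := hc' y hy
    exact ⟨U ×ˢ W, Finset.mem_image.2 ⟨(U, W), by simp [hU, hW], rfl⟩, hxU, hyW⟩
  · intro Z hZ x hx y hy
    obtain ⟨⟨U, W⟩, hUW, rfl⟩ := Finset.mem_image.1 hZ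
    rw [Finset.mem_product] at hUW
    exact max_le (hd U hUW.1 _ hx.1 _ hy.1) (hd' W hUW.2 _ hx.2 _ hy.2)
  · calc ((((𝒰 ×ˢ 𝒲).image fun p => p.1 ×ˢ p.2).card : ℕ) : ℝ) ≤ ((𝒰 ×ˢ 𝒲).card : ℕ) := by
          exact_mod_cast Finset.card_image_le
      _ = 𝒰.card * 𝒲.card := by rw [Finset.card_product]; push_cast; rfl
      _ ≤ N * M := by gcongr; exact (Nat.cast_nonneg _).trans hN

/-- Along the scales `r₀ / (n + 1)` the sums of `s`-th powers of diameters stay below `C * r ^ (-s)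
* r ^ s = C`, so the `s`-dimensional Hausdorff measure is finite. -/
theorem dimH_le_of_isCoverable {X : Type*} [MetricSpace X] {K : Set X} {C r₀ s : ℝ} (hr₀ : 0 < r₀)
    (hs : 0 ≤ s) (h : ∀ r, 0 < r → r ≤ r₀ → IsCoverable K r (C * r ^ (-s))) :
    dimH K ≤ ENNReal.ofReal s := by
  borelize X
  have hr : ∀ n : ℕ, 0 < r₀ / (n + 1) := fun n => by positivity
  have hr' : ∀ n : ℕ, r₀ / (n + 1) ≤ r₀ := fun n =>
    div_le_self hr₀.le (by linarith [(Nat.cast_nonneg n : (0 : ℝ) ≤ n)])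
  choose 𝒰 hc hd hN using fun n : ℕ => h _ (hr n) (hr' n)
  have hdiam : ∀ n, ∀ U : 𝒰 n, Metric.ediam (U : Set X) ≤ ENNReal.ofReal (r₀ / (n + 1)) :=
    fun n U => Metric.ediam_le fun x hx y hy => by
      rw [edist_dist]
      exact ENNReal.ofReal_le_ofReal (hd n U U.2 x hx y hy)
  have hlim : Tendsto (fun n : ℕ => ENNReal.ofReal (r₀ / (n + 1))) atTop (𝓝 0) := by
    rw [← ENNReal.ofReal_zero]
    refine (ENNReal.continuous_ofReal.tendsto _).comp ?_
    exact tendsto_const_nhds.div_atTop (tendsto_natCast_atTop_atTop.atTop_add tendsto_const_nhds)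
  have key := MeasureTheory.Measure.hausdorffMeasure_le_liminf_sum (X := X) s K _ hlim
    (fun n (U : 𝒰 n) => (U : Set X)) (Eventually.of_forall hdiam)
    (Eventually.of_forall fun n x hx => by
      obtain ⟨U, hU, hxU⟩ := hc n x hx
      exact mem_iUnion.2 ⟨⟨U, hU⟩, hxU⟩)
  have hsum : ∀ n, ∑ U : 𝒰 n, Metric.ediam (U : Set X) ^ s ≤ ENNReal.ofReal C := fun n => by
    calc ∑ U : 𝒰 n, Metric.ediam (U : Set X) ^ s
        ≤ ∑ _U : 𝒰 n, ENNReal.ofReal (r₀ / (n + 1)) ^ s :=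
          Finset.sum_le_sum fun U _ => ENNReal.rpow_le_rpow (hdiam n U) hs
      _ = ENNReal.ofReal ((𝒰 n).card * (r₀ / (n + 1)) ^ s) := by
          rw [Finset.sum_const, Finset.card_univ, Fintype.card_coe, nsmul_eq_mul,
            ENNReal.ofReal_rpow_of_pos (hr n), ENNReal.ofReal_mul (by positivity),
            ENNReal.ofReal_natCast]
      _ ≤ ENNReal.ofReal C := ENNReal.ofReal_le_ofReal <| by
          have := hr n
          calc ((𝒰 n).card : ℝ) * (r₀ / (n + 1)) ^ s
              ≤ C * (r₀ / (n + 1)) ^ (-s) * (r₀ / (n + 1)) ^ s := by gcongr; exact hN n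
            _ = C := by
              rw [mul_assoc, ← Real.rpow_add (hr n), neg_add_cancel, Real.rpow_zero, mul_one]
  have hfin : MeasureTheory.Measure.hausdorffMeasure s K ≠ ∞ := by
    refine ne_top_of_le_ne_top (ENNReal.ofReal_ne_top (r := C)) (key.trans ?_)
    refine (liminf_le_liminf (Eventually.of_forall hsum)).trans ?_
    simp
  have := dimH_le_of_hausdorffMeasure_ne_top (d := s.toNNReal) (s := K)
    (by rwa [Real.coe_toNNReal _ hs])
  exact this

theorem dimH_prod_self_le_of_isCoverable {X : Type*} [MetricSpace X] {K : Set X} {C r₀ s : ℝ}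
    (hr₀ : 0 < r₀) (hs : 0 ≤ s) (h : ∀ r, 0 < r → r ≤ r₀ → IsCoverable K r (C * r ^ (-s))) :
    dimH (K ×ˢ K) ≤ ENNReal.ofReal (2 * s) := by
  refine dimH_le_of_isCoverable (C := C * C) hr₀ (by positivity) fun r hr hr' => ?_
  have := (h r hr hr').prod (h r hr hr')
  convert this using 1
  rw [mul_mul_mul_comm, ← Real.rpow_add hr]
  ring_nf

/-! ### Expansion of a number with respect to a probability vector -/

/-- The interval `[0, 1)` is cut into consecutive half-open intervals of lengths `q j`; `t'` is the
relative position of `t` in its own. Since empty intervals contain no point, digits of probability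
zero never occur, which later yields admissibility. -/
theorem exists_digit {m : ℕ} (q : Fin m → ℝ) (hq : ∀ j, 0 ≤ q j) (hsum : ∑ j, q j = 1) (t : ℝ)
    (ht : t ∈ Ico (0 : ℝ) 1) :
    ∃ j, ∃ t' ∈ Ico (0 : ℝ) 1, 0 < q j ∧ t = ∑ i ∈ Finset.Iio j, q i + q j * t' := by
  have hex : ∃ j, t < ∑ i ∈ Finset.Iic j, q i := by
    have : NeZero m := ⟨by rintro rfl; simp at hsum⟩
    refine ⟨⊤, ?_⟩
    rw [Finset.Iic_top, hsum]
    exact ht.2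
  obtain ⟨j, hj, hmin⟩ := WellFounded.has_min wellFounded_lt {j | t < ∑ i ∈ Finset.Iic j, q i} hex
  have hIic : ∑ i ∈ Finset.Iic j, q i = q j + ∑ i ∈ Finset.Iio j, q i := by
    rw [← Finset.Iio_insert, Finset.sum_insert (by simp)]
  have hle : ∑ i ∈ Finset.Iio j, q i ≤ t := by
    rcases (Finset.Iio j).eq_empty_or_nonempty with he | hne
    · rw [he, Finset.sum_empty]; exact ht.1
    · set k := (Finset.Iio j).max' hne with hk
      have hkj : k < j := Finset.mem_Iio.1 (Finset.max'_mem _ _)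
      have hkk : Finset.Iio j = Finset.Iic k := by
        ext i
        rw [Finset.mem_Iic, Finset.mem_Iio]
        exact ⟨fun h => Finset.le_max' _ _ (Finset.mem_Iio.2 h), fun h => h.trans_lt hkj⟩
      rw [hkk]
      exact not_lt.1 fun h => hmin k h hkj
  have hj' : t < q j + ∑ i ∈ Finset.Iio j, q i := hIic ▸ hj
  have hqj : 0 < q j := by linarith
  refine ⟨j, (t - ∑ i ∈ Finset.Iio j, q i) / q j, ⟨by apply div_nonneg <;> linarith, ?_⟩, hqj, ?_⟩
  · rw [div_lt_one hqj]; linarith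
  · field_simp; ring

/-! ### Systems of uniformly separated similarities -/

/-- The standing assumptions: `f` expands each compact set `V i` by the factor `lam i > 1`, its image
contains every `V j` with `A i j = 1`, and the sets `V i` are uniformly separated. -/
structure IsExpandingSystem {X : Type*} [MetricSpace X] {m : ℕ} (A : Matrix (Fin m) (Fin m) ℕ)
    (f : X → X) (V : Fin m → Set X) (lam : Fin m → ℝ) : Prop where
  isCompact : ∀ i, IsCompact (V i)
  nonempty : ∀ i, (V i).Nonempty
  one_lt : ∀ i, 1 < lam i
  dist_eq : ∀ i, ∀ x ∈ V i, ∀ y ∈ V i, dist (f x) (f y) = lam i * dist x y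
  covers : ∀ i j, A i j = 1 → V j ⊆ f '' V i
  separated : ∃ c > 0, ∀ i j, i ≠ j → ∀ x ∈ V i, ∀ y ∈ V j, c ≤ dist x y

/-- The orbit of `x` visits the sets `V i` in the order prescribed by `a`. -/
def HasItinerary {X : Type*} {m : ℕ} (f : X → X) (V : Fin m → Set X) (a : ℕ → Fin m) (x : X) :
    Prop :=
  ∀ n, f^[n] x ∈ V (a n)

section Itinerary

variable {X : Type*} {m : ℕ} {A : Matrix (Fin m) (Fin m) ℕ} {f : X → X} {V : Fin m → Set X}

theorem mem_codedSet {x : X} :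
    x ∈ codedSet A f V ↔ ∃ a ∈ subshiftSpace A, HasItinerary f V a x := by
  simp [codedSet, HasItinerary]

theorem HasItinerary.shift {a : ℕ → Fin m} {x : X} (h : HasItinerary f V a x) :
    HasItinerary f V (fun n => a (n + 1)) (f x) := fun n => by
  rw [← Function.iterate_succ_apply]
  exact h (n + 1)

theorem HasItinerary.shift_iterate {a : ℕ → Fin m} {x : X} (h : HasItinerary f V a x) (k : ℕ) :
    HasItinerary f V (fun n => a (k + n)) (f^[k] x) := fun n => by
  rw [← Function.iterate_add_apply, add_comm n k]
  exact h (k + n)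

theorem shift_mem_subshiftSpace {a : ℕ → Fin m} (h : a ∈ subshiftSpace A) :
    (fun n => a (n + 1)) ∈ subshiftSpace A := fun n => h (n + 1)

theorem codedSet_subset (A : Matrix (Fin m) (Fin m) ℕ) (f : X → X) (V : Fin m → Set X) :
    codedSet A f V ⊆ ⋃ i, V i := fun _ hx => by
  obtain ⟨a, -, hax⟩ := mem_codedSet.1 hx
  exact mem_iUnion.2 ⟨a 0, hax 0⟩

end Itinerary

/-! ### Coding by itineraries and topology of the coded set -/

theorem tendsto_const_div_pow_atTop {B l : ℝ} (hl : 1 < l) :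
    Tendsto (fun n : ℕ => B / l ^ n) atTop (𝓝 0) :=
  tendsto_const_nhds.div_atTop (tendsto_pow_atTop_atTop_of_one_lt hl)

theorem pow_le_prod_range {m : ℕ} {lam : Fin m → ℝ} {l : ℝ} (hl : 0 ≤ l)
    (hlam : ∀ i, l ≤ lam i) (a : ℕ → Fin m) (n : ℕ) :
    l ^ n ≤ ∏ k ∈ Finset.range n, lam (a k) := by
  calc l ^ n = ∏ _k ∈ Finset.range n, l := by simp
    _ ≤ _ := Finset.prod_le_prod (fun _ _ => hl) fun k _ => hlam _

namespace IsExpandingSystem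

variable {X : Type*} [MetricSpace X] {m : ℕ} {A : Matrix (Fin m) (Fin m) ℕ}
  {f : X → X} {V : Fin m → Set X} {lam : Fin m → ℝ}

theorem lam_pos (h : IsExpandingSystem A f V lam) (i : Fin m) : 0 < lam i :=
  one_pos.trans (h.one_lt i)

theorem continuousOn (h : IsExpandingSystem A f V lam) (i : Fin m) : ContinuousOn f (V i) := by
  have : LipschitzOnWith (lam i).toNNReal f (V i) := LipschitzOnWith.of_dist_le_mul
    fun x hx y hy => by rw [Real.coe_toNNReal _ (h.lam_pos i).le, h.dist_eq i x hx y hy]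
  exact this.continuousOn

theorem exists_ratio_bounds [NeZero m] (h : IsExpandingSystem A f V lam) :
    ∃ l L : ℝ, 1 < l ∧ (∀ i, l ≤ lam i) ∧ ∀ i, lam i ≤ L := by
  obtain ⟨i, hi⟩ := Finite.exists_min lam
  obtain ⟨j, hj⟩ := Finite.exists_max lam
  exact ⟨lam i, lam j, h.one_lt i, hi, hj⟩

theorem exists_diam_bound (h : IsExpandingSystem A f V lam) :
    ∃ B > 0, ∀ i, ∀ x ∈ V i, ∀ y ∈ V i, dist x y ≤ B := by
  have hb : Bornology.IsBounded (⋃ i, V i) :=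
    (Bornology.isBounded_iUnion).2 fun i => (h.isCompact i).isBounded
  obtain ⟨B, hB⟩ := Metric.isBounded_iff.1 hb
  exact ⟨max B 1, lt_max_of_lt_right one_pos, fun i x hx y hy =>
    (hB (mem_iUnion.2 ⟨i, hx⟩) (mem_iUnion.2 ⟨i, hy⟩)).trans (le_max_left _ _)⟩

theorem eq_of_mem (h : IsExpandingSystem A f V lam) {i j : Fin m} {x : X} (hi : x ∈ V i)
    (hj : x ∈ V j) : i = j := by
  by_contra hij
  obtain ⟨c, hc, hs⟩ := h.separated
  have := hs i j hij x hi x hj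
  rw [dist_self] at this
  linarith

/-- Along a common itinerary distances are multiplied by the expansion factors. -/
theorem dist_iterate (h : IsExpandingSystem A f V lam) {a b : ℕ → Fin m} {x y : X}
    (hx : HasItinerary f V a x) (hy : HasItinerary f V b y) (n : ℕ) (hab : ∀ k < n, a k = b k) :
    dist (f^[n] x) (f^[n] y) = (∏ k ∈ Finset.range n, lam (a k)) * dist x y := by
  induction n with
  | zero => simp
  | succ n ih =>
    rw [Function.iterate_succ_apply', Function.iterate_succ_apply',
      h.dist_eq (a n) _ (hx n) _ (hab n n.lt_succ_self ▸ hy n),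
      ih fun k hk => hab k (hk.trans n.lt_succ_self), Finset.prod_range_succ]
    ring

theorem exists_dist_le [NeZero m] (h : IsExpandingSystem A f V lam) :
    ∃ B > 0, ∃ l : ℝ, 1 < l ∧ ∀ (a b : ℕ → Fin m) (x y : X), HasItinerary f V a x →
      HasItinerary f V b y → ∀ n, (∀ k ≤ n, a k = b k) → dist x y ≤ B / l ^ n := by
  obtain ⟨B, hB, hBd⟩ := h.exists_diam_bound
  obtain ⟨l, -, hl, hlam, -⟩ := h.exists_ratio_bounds
  refine ⟨B, hB, l, hl, fun a b x y hx hy n hab => ?_⟩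
  rw [le_div_iff₀ (by positivity), mul_comm]
  calc l ^ n * dist x y ≤ (∏ k ∈ Finset.range n, lam (a k)) * dist x y := by
        gcongr; exact pow_le_prod_range (by linarith) hlam a n
    _ = dist (f^[n] x) (f^[n] y) := (h.dist_iterate hx hy n fun k hk => hab k hk.le).symm
    _ ≤ B := hBd (a n) _ (hx n) _ (hab n le_rfl ▸ hy n)

theorem itinerary_unique (h : IsExpandingSystem A f V lam) {a b : ℕ → Fin m} {x : X}
    (hx : HasItinerary f V a x) (hx' : HasItinerary f V b x) : a = b :=
  funext fun n => h.eq_of_mem (hx n) (hx' n)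

theorem point_unique [NeZero m] (h : IsExpandingSystem A f V lam) {a : ℕ → Fin m} {x y : X}
    (hx : HasItinerary f V a x) (hy : HasItinerary f V a y) : x = y := by
  obtain ⟨B, -, l, hl, hd⟩ := h.exists_dist_le
  refine dist_le_zero.1 (ge_of_tendsto' (tendsto_const_div_pow_atTop (B := B) hl) fun n => ?_)
  exact hd a a x y hx hy n fun _ _ => rfl

theorem exists_hasItinerary (h : IsExpandingSystem A f V lam) {a : ℕ → Fin m}
    (ha : a ∈ subshiftSpace A) : ∃ x, HasItinerary f V a x := by
  -- The sequence is quantified inside because a point is found backwards: first one for the shifted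
  -- sequence, then a preimage of it in `V (a 0)`.
  have key : ∀ n, ∀ a ∈ subshiftSpace A, {x | ∀ k ≤ n, f^[k] x ∈ V (a k)}.Nonempty ∧
      IsClosed {x | ∀ k ≤ n, f^[k] x ∈ V (a k)} := by
    intro n
    induction n with
    | zero =>
      intro a _
      have : {x | ∀ k ≤ 0, f^[k] x ∈ V (a k)} = V (a 0) := by
        ext x
        simp
      rw [this]
      exact ⟨h.nonempty _, (h.isCompact _).isClosed⟩
    | succ n ih =>
      intro a ha
      obtain ⟨⟨y, hy⟩, hcl⟩ := ih _ (shift_mem_subshiftSpace ha)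
      have heq : {x | ∀ k ≤ n + 1, f^[k] x ∈ V (a k)} =
          V (a 0) ∩ f ⁻¹' {x | ∀ k ≤ n, f^[k] x ∈ V (a (k + 1))} := by
        ext x
        simp only [mem_ofPred_eq, mem_inter_iff, mem_preimage]
        refine ⟨fun hx => ⟨hx 0 (Nat.zero_le _), fun k hk => hx (k + 1) (by omega)⟩, ?_⟩
        rintro ⟨h0, h1⟩ k hk
        cases k with
        | zero => exact h0
        | succ k => exact h1 k (by omega)
      rw [heq]
      refine ⟨?_, (h.continuousOn _).preimage_isClosed_of_isClosed (h.isCompact _).isClosed hcl⟩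
      obtain ⟨x, hx, rfl⟩ := h.covers (a 0) (a 1) (ha 0) (hy 0 (Nat.zero_le _))
      exact ⟨x, hx, hy⟩
  have h0 : {x | ∀ k ≤ 0, f^[k] x ∈ V (a k)} = V (a 0) := by
    ext x
    simp
  obtain ⟨x, hx⟩ := IsCompact.nonempty_iInter_of_sequence_nonempty_isCompact_isClosed
    (fun n => {x | ∀ k ≤ n, f^[k] x ∈ V (a k)})
    (fun n x hx k hk => hx k (hk.trans n.le_succ)) (fun n => (key n a ha).1)
    (by rw [h0]; exact h.isCompact _) (fun n => (key n a ha).2)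
  exact ⟨x, fun n => mem_iInter.1 hx n n le_rfl⟩

/-- The point with a given admissible itinerary. -/
noncomputable def point (h : IsExpandingSystem A f V lam) (a : subshiftSpace A) : X :=
  (h.exists_hasItinerary a.2).choose

theorem hasItinerary_point (h : IsExpandingSystem A f V lam) (a : subshiftSpace A) :
    HasItinerary f V a.1 (h.point a) :=
  (h.exists_hasItinerary a.2).choose_spec

theorem point_mem (h : IsExpandingSystem A f V lam) (a : subshiftSpace A) :
    h.point a ∈ codedSet A f V :=
  mem_codedSet.2 ⟨a.1, a.2, h.hasItinerary_point a⟩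

theorem point_injective (h : IsExpandingSystem A f V lam) : Function.Injective h.point :=
  fun a b hab => Subtype.ext <|
    h.itinerary_unique (h.hasItinerary_point a) (hab ▸ h.hasItinerary_point b)

theorem exists_point_eq [NeZero m] (h : IsExpandingSystem A f V lam) {x : X}
    (hx : x ∈ codedSet A f V) : ∃ a, h.point a = x := by
  obtain ⟨a, ha, hax⟩ := mem_codedSet.1 hx
  exact ⟨⟨a, ha⟩, h.point_unique (h.hasItinerary_point ⟨a, ha⟩) hax⟩

theorem map_point [NeZero m] (h : IsExpandingSystem A f V lam) (a : subshiftSpace A) :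
    f (h.point a) = h.point (subshift A a) :=
  h.point_unique (h.hasItinerary_point a).shift (h.hasItinerary_point (subshift A a))

theorem continuous_point [NeZero m] (h : IsExpandingSystem A f V lam) : Continuous h.point := by
  obtain ⟨B, -, l, hl, hd⟩ := h.exists_dist_le
  rw [continuous_iff_continuousAt]
  intro a
  rw [ContinuousAt, Metric.tendsto_nhds]
  intro ε hε
  obtain ⟨n, hn⟩ := ((tendsto_const_div_pow_atTop (B := B) hl).eventually (gt_mem_nhds hε)).exists
  have hev : ∀ᶠ b : subshiftSpace A in 𝓝 a, ∀ k ∈ Finset.range (n + 1), b.1 k = a.1 k := by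
    rw [Filter.eventually_all_finset]
    intro k _
    have hc : Continuous fun b : subshiftSpace A => b.1 k :=
      (continuous_apply k).comp continuous_subtype_val
    exact hc.continuousAt.eventually ((isOpen_discrete {a.1 k}).mem_nhds rfl)
  filter_upwards [hev] with b hb
  refine (hd b.1 a.1 _ _ (h.hasItinerary_point b) (h.hasItinerary_point a) n
    fun k hk => hb k (Finset.mem_range.2 (by omega))).trans_lt hn

theorem isClosed_subshiftSpace (A : Matrix (Fin m) (Fin m) ℕ) : IsClosed (subshiftSpace A) := by
  have : subshiftSpace A = ⋂ n, (fun a : ℕ → Fin m => A (a n) (a (n + 1))) ⁻¹' {1} := by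
    ext a
    simp [subshiftSpace]
  rw [this]
  refine isClosed_iInter fun n => (isClosed_discrete _).preimage ?_
  have hA : Continuous fun p : Fin m × Fin m => A p.1 p.2 := continuous_of_discreteTopology
  have hB : Continuous fun a : ℕ → Fin m => (a n, a (n + 1)) := by fun_prop
  exact hA.comp hB

/-- The coding homeomorphism. -/
noncomputable def coding [NeZero m] (h : IsExpandingSystem A f V lam) :
    subshiftSpace A ≃ₜ codedSet A f V :=
  haveI : CompactSpace (subshiftSpace A) :=
    isCompact_iff_compactSpace.1 (isClosed_subshiftSpace A).isCompact
  Continuous.homeoOfEquivCompactToT2 (f := Equiv.ofBijective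
      (fun a => (⟨h.point a, h.point_mem a⟩ : codedSet A f V))
      ⟨fun a b hab => h.point_injective (congrArg Subtype.val hab), fun x => by
        obtain ⟨a, ha⟩ := h.exists_point_eq x.2
        exact ⟨a, Subtype.ext ha⟩⟩)
    (h.continuous_point.subtype_mk _)

theorem isCompact_codedSet [NeZero m] (h : IsExpandingSystem A f V lam) :
    IsCompact (codedSet A f V) := by
  have : CompactSpace (subshiftSpace A) :=
    isCompact_iff_compactSpace.1 (isClosed_subshiftSpace A).isCompact
  exact isCompact_iff_compactSpace.2 h.coding.compactSpace

theorem isTotallyDisconnected_codedSet [NeZero m] (h : IsExpandingSystem A f V lam) :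
    IsTotallyDisconnected (codedSet A f V) := by
  rw [← totallyDisconnectedSpace_subtype_iff]
  exact h.coding.symm.isEmbedding.isTotallyDisconnected_range.1
    (isTotallyDisconnected_of_totallyDisconnectedSpace _)

theorem preperfect_codedSet [NeZero m] (h : IsExpandingSystem A f V lam)
    (hA : ∀ a ∈ subshiftSpace A, ∀ n, ∃ b ∈ subshiftSpace A, b ≠ a ∧ ∀ k ≤ n, b k = a k) :
    Preperfect (codedSet A f V) := by
  obtain ⟨B, -, l, hl, hd⟩ := h.exists_dist_le
  rw [preperfect_iff_nhds]
  intro x hx U hU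
  obtain ⟨a, rfl⟩ := h.exists_point_eq hx
  obtain ⟨ε, hε, hεU⟩ := Metric.mem_nhds_iff.1 hU
  obtain ⟨n, hn⟩ := ((tendsto_const_div_pow_atTop (B := B) hl).eventually (gt_mem_nhds hε)).exists
  obtain ⟨b, hb, hba, hbk⟩ := hA a.1 a.2 n
  refine ⟨h.point ⟨b, hb⟩, ⟨hεU ?_, h.point_mem _⟩, fun e => hba ?_⟩
  · exact (hd b a.1 _ _ (h.hasItinerary_point ⟨b, hb⟩) (h.hasItinerary_point a) n hbk).trans_lt hn
  · exact congrArg Subtype.val (h.point_injective e)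

theorem image_codedSet [NeZero m] (h : IsExpandingSystem A f V lam)
    (hA : ∀ j, ∃ i, A i j = 1) : f '' codedSet A f V = codedSet A f V := by
  apply Subset.antisymm
  · rintro _ ⟨x, hx, rfl⟩
    obtain ⟨a, ha, hax⟩ := mem_codedSet.1 hx
    exact mem_codedSet.2 ⟨_, shift_mem_subshiftSpace ha, hax.shift⟩
  · intro x hx
    obtain ⟨a, ha, hax⟩ := mem_codedSet.1 hx
    -- A preimage arises by prepending an admissible symbol to the itinerary.
    obtain ⟨i, hi⟩ := hA (a 0)
    obtain ⟨y, hy, rfl⟩ := h.covers i (a 0) hi (hax 0)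
    refine ⟨y, mem_codedSet.2 ⟨fun n => Nat.casesOn n i a, ?_, ?_⟩, rfl⟩
    · rintro (_ | n)
      · exact hi
      · exact ha n
    · rintro (_ | n)
      · exact hy
      · exact hax n

end IsExpandingSystem

/-! ### The upper bound -/

theorem IsCoverable.mono {X : Type*} [MetricSpace X] {K L : Set X} {r N M : ℝ}
    (h : IsCoverable L r N) (hKL : K ⊆ L) (hNM : N ≤ M) : IsCoverable K r M := by
  obtain ⟨𝒰, hc, hd, hN⟩ := h
  exact ⟨𝒰, fun x hx => hc x (hKL hx), hd, hN.trans hNM⟩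

theorem IsCoverable.biUnion {X ι : Type*} [MetricSpace X] {s : Finset ι} {K : ι → Set X} {r : ℝ}
    {N : ι → ℝ} (h : ∀ i ∈ s, IsCoverable (K i) r (N i)) :
    IsCoverable (⋃ i ∈ s, K i) r (∑ i ∈ s, N i) := by
  classical
  choose! 𝒰 hc hd hN using h
  refine ⟨s.biUnion 𝒰, fun x hx => ?_, fun U hU => ?_, ?_⟩
  · obtain ⟨i, hi, hx⟩ := mem_iUnion₂.1 hx
    obtain ⟨U, hU, hxU⟩ := hc i hi x hx
    exact ⟨U, Finset.mem_biUnion.2 ⟨i, hi, hU⟩, hxU⟩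
  · obtain ⟨i, hi, hU⟩ := Finset.mem_biUnion.1 hU
    exact hd i hi U hU
  · calc ((s.biUnion 𝒰).card : ℝ) ≤ ((∑ i ∈ s, (𝒰 i).card : ℕ) : ℝ) := by
          exact_mod_cast Finset.card_biUnion_le
      _ = ∑ i ∈ s, ((𝒰 i).card : ℝ) := by push_cast; rfl
      _ ≤ _ := Finset.sum_le_sum hN

namespace IsExpandingSystem

variable {X : Type*} [MetricSpace X] {m : ℕ} {A : Matrix (Fin m) (Fin m) ℕ}
  {f : X → X} {V : Fin m → Set X} {lam : Fin m → ℝ}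

/-- On `V i` the map is a similarity, so pulling a cover back divides diameters by `lam i` and does
not increase the number of sets. -/
theorem isCoverable_preimage (h : IsExpandingSystem A f V lam) (i : Fin m) {K : Set X} {r N : ℝ}
    (hK : IsCoverable K (lam i * r) N) : IsCoverable (V i ∩ f ⁻¹' K) r N := by
  classical
  obtain ⟨𝒰, hc, hd, hN⟩ := hK
  refine ⟨𝒰.image fun U => V i ∩ f ⁻¹' U, fun x hx => ?_, fun W hW x hx y hy => ?_, ?_⟩
  · obtain ⟨U, hU, hxU⟩ := hc _ hx.2
    exact ⟨_, Finset.mem_image_of_mem _ hU, hx.1, hxU⟩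
  · obtain ⟨U, hU, rfl⟩ := Finset.mem_image.1 hW
    have := hd U hU _ hx.2 _ hy.2
    rw [h.dist_eq i x hx.1 y hy.1] at this
    exact le_of_mul_le_mul_left this (h.lam_pos i)
  · exact le_trans (by exact_mod_cast Finset.card_image_le) hN

theorem codedSet_inter_subset (i : Fin m) (h : IsExpandingSystem A f V lam) :
    codedSet A f V ∩ V i ⊆
      ⋃ j ∈ Finset.univ.filter (fun j => A i j = 1), V i ∩ f ⁻¹' (codedSet A f V ∩ V j) := by
  rintro x ⟨hx, hxi⟩
  obtain ⟨a, ha, hax⟩ := mem_codedSet.1 hx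
  have hi : i = a 0 := h.eq_of_mem hxi (hax 0)
  refine mem_iUnion₂.2 ⟨a 1, ?_, hxi, mem_codedSet.2 ⟨_, shift_mem_subshiftSpace ha, hax.shift⟩,
    hax.shift 0⟩
  rw [Finset.mem_filter, hi]
  exact ⟨Finset.mem_univ _, ha 0⟩

/-- The coded set is covered by `O(r ^ (-p))` sets of diameter at most `r`. -/
theorem exists_isCoverable [NeZero m] (h : IsExpandingSystem A f V lam) {p : ℝ} (hp : 0 ≤ p)
    {v : Fin m → ℝ} (hv : ∀ i, 0 < v i)
    (heig : ∀ i, ∑ j with A i j = 1, v j = lam i ^ p * v i) :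
    ∃ C r₀ : ℝ, 0 < r₀ ∧ ∀ r, 0 < r → r ≤ r₀ → IsCoverable (codedSet A f V) r (C * r ^ (-p)) := by
  obtain ⟨B, hB, hBd⟩ := h.exists_diam_bound
  obtain ⟨l, L, hl, hlam, hL⟩ := h.exists_ratio_bounds
  obtain ⟨i₀, hi₀⟩ := Finite.exists_min v
  have hL0 : 1 < L := (h.one_lt 0).trans_le (hL 0)
  -- Chosen so that the bound is at least 1 for all `r ≤ B * L`, where a single set suffices as soon
  -- as `B ≤ r`.
  set C := (B * L) ^ p / v i₀ with hC
  have hC0 : 0 ≤ C := div_nonneg (by positivity) (hv _).le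
  -- Here `n` bounds the number of expansions that bring `r` up to size `B`. A radius below `B`
  -- stays below `B * L` after one expansion, so the upper restriction on `r` is preserved.
  have key : ∀ n : ℕ, ∀ r, 0 < r → B ≤ r * l ^ n → r ≤ B * L → ∀ i,
      IsCoverable (codedSet A f V ∩ V i) r (C * v i * r ^ (-p)) := by
    have large : ∀ r, 0 < r → B ≤ r → r ≤ B * L → ∀ i,
        IsCoverable (codedSet A f V ∩ V i) r (C * v i * r ^ (-p)) := by
      intro r hr hBr hrL i
      refine ⟨{V i}, fun x hx => ⟨_, Finset.mem_singleton_self _, hx.2⟩, ?_, ?_⟩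
      · intro U hU x hx y hy
        rw [Finset.mem_singleton.1 hU] at hx hy
        exact (hBd i x hx y hy).trans hBr
      · have hr1 : (B * L) ^ (-p) ≤ r ^ (-p) :=
          Real.rpow_le_rpow_of_nonpos hr hrL (neg_nonpos.2 hp)
        have hBL : 0 < B * L := by positivity
        have := hv i₀
        calc (((({V i} : Finset (Set X)).card : ℕ)) : ℝ) = C * v i₀ * (B * L) ^ (-p) := by
              rw [hC, div_mul_cancel₀ _ (hv i₀).ne', ← Real.rpow_add hBL]
              simp
          _ ≤ C * v i * r ^ (-p) := by
              gcongr
              exact mul_nonneg hC0 (hv i).le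
              exact hi₀ i
    intro n
    induction n with
    | zero => exact fun r hr hBr => large r hr (by simpa using hBr)
    | succ n ih =>
      intro r hr hBr hrL i
      rcases le_or_gt B r with hBr' | hBr'
      · exact large r hr hBr' hrL i
      have hi := h.lam_pos i
      have hcov : ∀ j ∈ Finset.univ.filter (fun j => A i j = 1),
          IsCoverable (V i ∩ f ⁻¹' (codedSet A f V ∩ V j)) r (C * v j * (lam i * r) ^ (-p)) := by
        intro j _
        refine h.isCoverable_preimage i (ih _ (by positivity) ?_ ?_ j)
        · calc B ≤ r * l ^ (n + 1) := hBr
            _ = l * r * l ^ n := by ring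
            _ ≤ lam i * r * l ^ n := by gcongr; exact hlam i
        · calc lam i * r ≤ L * B := by gcongr; exact hL i
            _ = B * L := mul_comm _ _
      -- By the eigenvector equation the counts of the pieces add up to exactly the required bound,
      -- so no constant is lost in the induction.
      refine (IsCoverable.biUnion hcov).mono (codedSet_inter_subset i h) (le_of_eq ?_)
      rw [← Finset.sum_mul, ← Finset.mul_sum, heig i, Real.mul_rpow hi.le hr.le,
        Real.rpow_neg hi.le]
      have : lam i ^ p ≠ 0 := by positivity
      field_simp
  refine ⟨∑ i, C * v i, B * L, by positivity, fun r hr hrL => ?_⟩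
  obtain ⟨n, hn⟩ := ((tendsto_pow_atTop_atTop_of_one_lt hl).eventually_ge_atTop (B / r)).exists
  rw [div_le_iff₀' hr] at hn
  have := IsCoverable.biUnion (s := Finset.univ) fun i _ => key n r hr hn hrL i
  refine this.mono (fun x hx => ?_) (by rw [Finset.sum_mul])
  obtain ⟨i, hi⟩ := mem_iUnion.1 (codedSet_subset A f V hx)
  exact mem_iUnion₂.2 ⟨i, Finset.mem_univ _, hx, hi⟩

end IsExpandingSystem

/-! ### The lower bound -/

/-- The points of `[0, 1)` are expanded along an inhomogeneous Markov chain with transition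
probabilities `q n i j`, in such a way that each cylinder is no longer than its probability. -/
theorem exists_markov_expansion {m : ℕ} (q : ℕ → Fin m → Fin m → ℝ) (hq : ∀ n i j, 0 ≤ q n i j)
    (hsum : ∀ n i, ∑ j, q n i j = 1) (i₀ : Fin m) :
    ∃ a : Ico (0 : ℝ) 1 → ℕ → Fin m, (∀ t, a t 0 = i₀) ∧
      (∀ t n, 0 < q n (a t n) (a t (n + 1))) ∧
      ∀ t t' n, (∀ k ≤ n, a t k = a t' k) →
        dist t t' ≤ ∏ k ∈ Finset.range n, q k (a t k) (a t (k + 1)) := by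
  have hex : ∀ n i (t : Ico (0 : ℝ) 1), ∃ j, ∃ t' : Ico (0 : ℝ) 1, 0 < q n i j ∧
      (t : ℝ) = ∑ k ∈ Finset.Iio j, q n i k + q n i j * t' := fun n i t => by
    obtain ⟨j, t', ht', h1, h2⟩ := exists_digit (q n i) (hq n i) (hsum n i) t t.2
    exact ⟨j, ⟨t', ht'⟩, h1, h2⟩
  choose digit rem hpos hrem using hex
  let state : Ico (0 : ℝ) 1 → ℕ → Fin m × Ico (0 : ℝ) 1 := fun t n =>
    Nat.rec (i₀, t) (fun n s => (digit n s.1 s.2, rem n s.1 s.2)) n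
  refine ⟨fun t n => (state t n).1, fun t => rfl, fun t n => hpos _ _ _, ?_⟩
  -- Equal digits mean that the same affine maps are applied to both remainders, so the translations
  -- cancel.
  have key : ∀ t t' n, (∀ k ≤ n, (state t k).1 = (state t' k).1) →
      ((t : ℝ) - t') = (∏ k ∈ Finset.range n, q k (state t k).1 (state t (k + 1)).1) *
        ((state t n).2 - (state t' n).2) := by
    intro t t' n
    induction n with
    | zero => intro _; simp [state]
    | succ n ih =>
      intro hk
      rw [ih fun k hkn => hk k (by omega), Finset.prod_range_succ, mul_assoc]
      congr 1
      have h0 := hk n (by omega)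
      have h1 := hk (n + 1) le_rfl
      have e1 := hrem n (state t n).1 (state t n).2
      have e2 := hrem n (state t' n).1 (state t' n).2
      change ((state t n).2 : ℝ) = ∑ k ∈ Finset.Iio (state t (n + 1)).1, q n (state t n).1 k +
        q n (state t n).1 (state t (n + 1)).1 * (state t (n + 1)).2 at e1
      change ((state t' n).2 : ℝ) = ∑ k ∈ Finset.Iio (state t' (n + 1)).1, q n (state t' n).1 k +
        q n (state t' n).1 (state t' (n + 1)).1 * (state t' (n + 1)).2 at e2
      rw [← h0, ← h1] at e2
      rw [e1, e2]
      ring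
  intro t t' n hk
  have hprod : 0 ≤ ∏ k ∈ Finset.range n, q k (state t k).1 (state t (k + 1)).1 :=
    Finset.prod_nonneg fun k _ => hq _ _ _
  rw [Subtype.dist_eq, Real.dist_eq, key t t' n hk, abs_mul, abs_of_nonneg hprod]
  refine mul_le_of_le_one_right hprod (abs_le.2 ⟨?_, ?_⟩) <;>
    linarith [(state t n).2.2.1, (state t n).2.2.2, (state t' n).2.2.1, (state t' n).2.2.2]

/-- `F` has at most `δ n + O(1)` elements below `n`, for every `δ > 0`. -/
def IsSparse (F : Set ℕ) : Prop :=
  open Classical in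
  ∀ δ > 0, ∃ c : ℝ, ∀ n : ℕ, (((Finset.range n).filter (· ∈ F)).card : ℝ) ≤ δ * n + c

/-- Taking density `δ = ε * log l / log M` in the sparseness makes `M ^ (δ * n)` equal to `(l ^ n) ^
ε`. -/
theorem prod_range_ite_le_rpow {M l ε : ℝ} (hM : 1 < M) (hl : 1 < l) (hε : 0 < ε) {F : Set ℕ}
    (hF : IsSparse F) :
    open Classical in
    ∃ C > 0, ∀ n : ℕ, ∏ k ∈ Finset.range n, (if k ∈ F then M else 1) ≤ C * (l ^ n) ^ ε := by
  classical
  have hlogM := Real.log_pos hM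
  have hlogl := Real.log_pos hl
  obtain ⟨c, hc⟩ := hF (ε * Real.log l / Real.log M) (by positivity)
  refine ⟨M ^ c, by positivity, fun n => ?_⟩
  rw [← Finset.prod_filter, Finset.prod_const, ← Real.rpow_natCast M]
  calc M ^ ((((Finset.range n).filter (· ∈ F)).card : ℕ) : ℝ)
      ≤ M ^ (ε * Real.log l / Real.log M * n + c) := by
        refine Real.rpow_le_rpow_of_exponent_le hM.le ?_
        convert hc n
    _ = M ^ c * (l ^ n) ^ ε := by
        rw [Real.rpow_add (by positivity), mul_comm]
        congr 1
        rw [Real.rpow_def_of_pos (by positivity), Real.rpow_def_of_pos (by positivity),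
          Real.log_pow]
        congr 1
        field_simp

namespace IsExpandingSystem

variable {X : Type*} [MetricSpace X] {m : ℕ} {A : Matrix (Fin m) (Fin m) ℕ}
  {f : X → X} {V : Fin m → Set X} {lam : Fin m → ℝ}

/-- The quotients of `v` telescope, so the probability of a cylinder is the power `-p` of its
expansion up to a bounded factor. -/
theorem prod_transition (h : IsExpandingSystem A f V lam) {p : ℝ} {v : Fin m → ℝ}
    (hv : ∀ i, 0 < v i) (a : ℕ → Fin m) (n : ℕ) :
    ∏ k ∈ Finset.range n, (lam (a k) ^ (-p) * v (a (k + 1)) / v (a k)) =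
      (∏ k ∈ Finset.range n, lam (a k)) ^ (-p) * (v (a n) / v (a 0)) := by
  induction n with
  | zero => simp [(hv (a 0)).ne']
  | succ n ih =>
    rw [Finset.prod_range_succ, ih, Finset.prod_range_succ,
      Real.mul_rpow (Finset.prod_nonneg fun k _ => (h.lam_pos _).le) (h.lam_pos _).le]
    have := (hv (a n)).ne'
    have := (hv (a 0)).ne'
    field_simp

/-- If a family of points indexed by `[0, 1)` is coded so that the cylinders shrink as fast as the
`s`-th power of the inverse expansion, then the indexing is Hölder continuous from below. -/
theorem exists_dist_le_rpow [NeZero m] (h : IsExpandingSystem A f V lam) {s C : ℝ} (hs : 0 < s)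
    {i₀ : Fin m} {a : Ico (0 : ℝ) 1 → ℕ → Fin m} {ψ : Ico (0 : ℝ) 1 → X}
    (hψ : ∀ t, HasItinerary f V (a t) (ψ t)) (ha0 : ∀ t, a t 0 = i₀)
    (hC : ∀ t t' n, (∀ k ≤ n, a t k = a t' k) →
      dist t t' ≤ C * (∏ k ∈ Finset.range n, lam (a t k)) ^ (-s)) :
    ∃ C', 0 ≤ C' ∧ ∀ t t', dist t t' ≤ C' * dist (ψ t) (ψ t') ^ s := by
  obtain ⟨l, L, hl, hlam, hL⟩ := h.exists_ratio_bounds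
  obtain ⟨c, hc, hsep⟩ := h.separated
  have hL0 : 0 < L := (h.lam_pos 0).trans_le (hL 0)
  have hC0 : 0 ≤ C := by
    have := hC ⟨0, by simp⟩ ⟨0, by simp⟩ 0 fun _ _ => rfl
    simpa using this
  refine ⟨C * (L / c) ^ s, by positivity, fun t t' => ?_⟩
  by_cases hne : a t = a t'
  · have hlim : Tendsto (fun n : ℕ => C * (l ^ n) ^ (-s)) atTop (𝓝 (C * 0)) :=
      ((tendsto_rpow_neg_atTop hs).comp (tendsto_pow_atTop_atTop_of_one_lt hl)).const_mul C
    rw [mul_zero] at hlim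
    have hle : dist t t' ≤ 0 := ge_of_tendsto' hlim fun n => by
      refine (hC t t' n fun k _ => congrFun hne k).trans ?_
      gcongr ?_ * ?_
      exact Real.rpow_le_rpow_of_nonpos (by positivity)
        (pow_le_prod_range (by linarith) hlam _ _) (by linarith)
    exact hle.trans (by positivity)
  · have hex : ∃ n, a t n ≠ a t' n := Function.ne_iff.1 hne
    classical
    -- All sequences start with `i₀`, so the first disagreement is at a positive time. The one
    -- factor between `P` and that time is absorbed by `L` in the constant.
    obtain ⟨n, hn⟩ : ∃ n, Nat.find hex = n + 1 :=
      Nat.exists_eq_succ_of_ne_zero fun h0 => (h0 ▸ Nat.find_spec hex) (by rw [ha0, ha0])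
    have hdiff : a t (n + 1) ≠ a t' (n + 1) := hn ▸ Nat.find_spec hex
    have hagree : ∀ k ≤ n, a t k = a t' k := fun k hk =>
      not_not.1 (Nat.find_min hex (by omega))
    have hd := h.dist_iterate (hψ t) (hψ t') (n + 1) fun k hk => hagree k (by omega)
    have hcd : c ≤ dist (f^[n + 1] (ψ t)) (f^[n + 1] (ψ t')) :=
      hsep _ _ hdiff _ (hψ t _) _ (hψ t' _)
    set P := ∏ k ∈ Finset.range n, lam (a t k) with hP
    have hP0 : 0 < P := Finset.prod_pos fun k _ => h.lam_pos _
    have hPinv : P⁻¹ ≤ L / c * dist (ψ t) (ψ t') := by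
      rw [inv_le_iff_one_le_mul₀ hP0, div_mul_eq_mul_div, div_mul_eq_mul_div, le_div_iff₀ hc,
        one_mul]
      calc c ≤ P * lam (a t n) * dist (ψ t) (ψ t') := by
            rwa [hd, Finset.prod_range_succ] at hcd
        _ ≤ P * L * dist (ψ t) (ψ t') := by gcongr; exact hL _
        _ = L * dist (ψ t) (ψ t') * P := by ring
    calc dist t t' ≤ C * P ^ (-s) := hC t t' n hagree
      _ = C * P⁻¹ ^ s := by rw [Real.rpow_neg hP0.le, Real.inv_rpow hP0.le]
      _ ≤ C * (L / c * dist (ψ t) (ψ t')) ^ s := by gcongr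
      _ = C * (L / c) ^ s * dist (ψ t) (ψ t') ^ s := by
        rw [Real.mul_rpow (by positivity) dist_nonneg, mul_assoc]

/-- A family of coded points, of dimension `p` in the sense of Hölder exponents, whose itineraries
are prescribed by `u` along a sparse set `F` of times, wherever `A` allows it. -/
theorem exists_forced_family [NeZero m] (h : IsExpandingSystem A f V lam) {p : ℝ}
    {v : Fin m → ℝ} (hv : ∀ i, 0 < v i)
    (heig : ∀ i, ∑ j with A i j = 1, v j = lam i ^ p * v i) {F : Set ℕ} (hF : IsSparse F)
    (u : ℕ → Fin m) :
    ∃ (a : Ico (0 : ℝ) 1 → ℕ → Fin m) (ψ : Ico (0 : ℝ) 1 → X),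
      (∀ t, a t ∈ subshiftSpace A) ∧ (∀ t, HasItinerary f V (a t) (ψ t)) ∧
      (∀ t, ∀ n ∈ F, A (a t n) (u n) = 1 → a t (n + 1) = u n) ∧
      ∀ s, 0 < s → s < p → ∃ C, 0 ≤ C ∧ ∀ t t', dist t t' ≤ C * dist (ψ t) (ψ t') ^ s := by
  classical
  obtain ⟨l, L, hl, hlam, hL⟩ := h.exists_ratio_bounds
  let Q : Fin m → Fin m → ℝ := fun i j => lam i ^ (-p) * v j / v i
  have hQ : ∀ i j, 0 < Q i j := fun i j =>
    div_pos (mul_pos (Real.rpow_pos_of_pos (h.lam_pos i) _) (hv j)) (hv i)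
  obtain ⟨⟨i₁, j₁⟩, hmin⟩ := Finite.exists_min fun x : Fin m × Fin m => Q x.1 x.2
  obtain ⟨i₂, hmax⟩ := Finite.exists_max v
  obtain ⟨i₃, hmin'⟩ := Finite.exists_min v
  -- Forcing raises a transition probability to at most 1, which is at most `M * Q i j`; the 2
  -- ensures `log M > 0`.
  set M := max 2 (Q i₁ j₁)⁻¹ with hM
  have hM1 : 1 < M := lt_max_of_lt_left one_lt_two
  have hMQ : ∀ i j, 1 ≤ M * Q i j := fun i j => by
    calc 1 = (Q i₁ j₁)⁻¹ * Q i₁ j₁ := (inv_mul_cancel₀ (hQ _ _).ne').symm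
      _ ≤ M * Q i j := mul_le_mul (le_max_right _ _) (hmin (i, j)) (hQ _ _).le (by linarith)
  -- At a time of `F` from which `u n` is admissible the row becomes a point mass, so that `u n` is
  -- the symbol at time `n + 1`.
  let q : ℕ → Fin m → Fin m → ℝ := fun n i j =>
    if n ∈ F ∧ A i (u n) = 1 then (if j = u n then 1 else 0) else if A i j = 1 then Q i j else 0
  have hq0 : ∀ n i j, 0 ≤ q n i j := fun n i j => by
    have := (hQ i j).le
    simp only [q]
    split_ifs <;> first | exact zero_le_one | exact le_rfl | exact this
  have hqsum : ∀ n i, ∑ j, q n i j = 1 := fun n i => by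
    simp only [q]
    by_cases hn : n ∈ F ∧ A i (u n) = 1
    · simp [hn]
    · simp only [hn, if_false]
      rw [← Finset.sum_filter, ← Finset.sum_div, ← Finset.mul_sum, heig i, ← mul_assoc,
        ← Real.rpow_add (h.lam_pos i), neg_add_cancel, Real.rpow_zero, one_mul,
        div_self (hv i).ne']
  have hqA : ∀ n i j, 0 < q n i j → A i j = 1 := fun n i j hij => by
    simp only [q] at hij
    split_ifs at hij with h1 h2 h3
    · rw [h2]; exact h1.2
    · exact absurd hij (lt_irrefl _)
    · exact h3
    · exact absurd hij (lt_irrefl _)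
  have hqu : ∀ n i j, 0 < q n i j → n ∈ F → A i (u n) = 1 → j = u n := fun n i j hij hn hA => by
    by_contra hj
    simp [q, hn, hA, hj] at hij
  have hqQ : ∀ n i j, q n i j ≤ (if n ∈ F then M else 1) * Q i j := fun n i j => by
    have hMQ' := hMQ i j
    have hQ' := hQ i j
    simp only [q]
    split_ifs with h1 h2 h3 h4 h5 h6 <;> first | linarith | (exfalso; tauto) | nlinarith
  obtain ⟨a, ha0, hapos, hadist⟩ := exists_markov_expansion q hq0 hqsum 0
  have haA : ∀ t, a t ∈ subshiftSpace A := fun t n => hqA _ _ _ (hapos t n)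
  choose ψ hψ using fun t => h.exists_hasItinerary (haA t)
  refine ⟨a, ψ, haA, hψ, fun t n hn hA => hqu _ _ _ (hapos t n) hn hA, fun s hs hsp => ?_⟩
  obtain ⟨C, hC, hCn⟩ := prod_range_ite_le_rpow hM1 hl (sub_pos.2 hsp) hF
  refine h.exists_dist_le_rpow (C := C * (v i₂ / v i₃)) hs hψ ha0 fun t t' n hk => ?_
  set P := ∏ k ∈ Finset.range n, lam (a t k) with hP
  have hlP : l ^ n ≤ P := pow_le_prod_range (by linarith) hlam _ _
  have hP0 : 0 < P := lt_of_lt_of_le (by positivity) hlP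
  have hv2 := hv i₂
  have hv3 := hv i₃
  calc dist t t' ≤ ∏ k ∈ Finset.range n, q k (a t k) (a t (k + 1)) := hadist t t' n hk
    _ ≤ ∏ k ∈ Finset.range n, ((if k ∈ F then M else 1) * Q (a t k) (a t (k + 1))) :=
        Finset.prod_le_prod (fun k _ => hq0 _ _ _) fun k _ => hqQ _ _ _
    _ = (∏ k ∈ Finset.range n, if k ∈ F then M else 1) * (P ^ (-p) * (v (a t n) / v (a t 0))) := by
        rw [Finset.prod_mul_distrib, h.prod_transition hv]
    -- The price of the forced digits is paid by the gap `p - s`.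
    _ ≤ (C * P ^ (p - s)) * (P ^ (-p) * (v i₂ / v i₃)) := by
        have h1 : (l ^ n) ^ (p - s) ≤ P ^ (p - s) :=
          Real.rpow_le_rpow (by positivity) hlP (sub_pos.2 hsp).le
        have h2 : v (a t n) / v (a t 0) ≤ v i₂ / v i₃ :=
          div_le_div₀ hv2.le (hmax _) hv3 (hmin' _)
        have h3 : 0 ≤ v (a t n) / v (a t 0) := (div_pos (hv _) (hv _)).le
        refine mul_le_mul ((hCn n).trans (by gcongr)) (by gcongr) (by positivity) (by positivity)
    _ = C * (v i₂ / v i₃) * (P ^ (p - s) * P ^ (-p)) := by ring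
    _ = C * (v i₂ / v i₃) * P ^ (-s) := by
        rw [← Real.rpow_add hP0]
        ring_nf

end IsExpandingSystem

/-! ### A sparse set of times containing arbitrarily long intervals -/

/-- The union of the intervals `[2 ^ k, 2 ^ k + k]`. -/
def dyadicWindows : Set ℕ := {n | n ≠ 0 ∧ n - 2 ^ Nat.log 2 n ≤ Nat.log 2 n}

theorem log_two_pow_add {k i : ℕ} (hik : i ≤ k) : Nat.log 2 (2 ^ k + i) = k := by
  have := Nat.lt_two_pow_self (n := k)
  refine Nat.log_eq_of_pow_le_of_lt_pow (by omega) ?_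
  rw [pow_succ]
  omega

theorem two_pow_add_mem_dyadicWindows {k i : ℕ} (hik : i ≤ k) : 2 ^ k + i ∈ dyadicWindows := by
  refine ⟨by positivity, ?_⟩
  rw [log_two_pow_add hik]
  omega

/-- An element is determined by its binary logarithm and its offset in the window, both at most
`Nat.log 2 n` below `n`; a squared logarithm is eventually below `δ * n`. -/
theorem isSparse_dyadicWindows : IsSparse dyadicWindows := by
  classical
  intro δ hδ
  have hlim := (tendsto_pow_const_div_const_pow_of_one_lt 2 (one_lt_two (α := ℝ))).comp
    (tendsto_add_atTop_nat 1)
  obtain ⟨K₀, hK₀⟩ := eventually_atTop.1 (hlim.eventually (gt_mem_nhds (half_pos hδ)))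
  have hbound : ∀ K : ℕ, ((K : ℝ) + 1) ^ 2 ≤ δ * 2 ^ K + (K₀ + 1) ^ 2 := by
    intro K
    rcases le_total K₀ K with hK | hK
    · have h1 := hK₀ K hK
      simp only [Function.comp_apply] at h1
      rw [div_lt_iff₀ (by positivity), pow_succ (2 : ℝ)] at h1
      push_cast at h1
      nlinarith [sq_nonneg ((K₀ : ℝ) + 1)]
    · have h1 : (K : ℝ) ≤ K₀ := by exact_mod_cast hK
      have h2 : 0 ≤ δ * 2 ^ K := by positivity
      have h3 : ((K : ℝ) + 1) ^ 2 ≤ (K₀ + 1) ^ 2 := by gcongr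
      linarith
  refine ⟨(K₀ + 1) ^ 2, fun n => ?_⟩
  rcases Nat.eq_zero_or_pos n with rfl | hn
  · simp only [Finset.range_zero, Finset.filter_empty, Finset.card_empty, Nat.cast_zero, mul_zero, zero_add]
    positivity
  have hcard : ((Finset.range n).filter (· ∈ dyadicWindows)).card ≤ (Nat.log 2 n + 1) ^ 2 := by
    rw [sq, ← Finset.card_range (Nat.log 2 n + 1), ← Finset.card_product]
    refine Finset.card_le_card_of_injOn (fun k => (Nat.log 2 k, k - 2 ^ Nat.log 2 k)) ?_ ?_
    · intro k hk
      simp only [Finset.coe_filter, Finset.mem_range] at hk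
      have hlog := Nat.log_mono_right (b := 2) hk.1.le
      have := hk.2.2
      simp only [Finset.coe_product, mem_prod, Finset.coe_range, mem_Iio]
      omega
    · intro k hk k' hk' e
      simp only [Finset.coe_filter, Finset.mem_range] at hk hk'
      have h1 := Nat.pow_log_le_self 2 hk.2.1
      have h2 := Nat.pow_log_le_self 2 hk'.2.1
      rw [Prod.mk.injEq] at e
      obtain ⟨e1, e2⟩ := e
      rw [← e1] at h2 e2
      omega
  have hpow : (2 : ℝ) ^ Nat.log 2 n ≤ n := by exact_mod_cast Nat.pow_log_le_self 2 hn.ne'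
  calc ((((Finset.range n).filter (· ∈ dyadicWindows)).card : ℕ) : ℝ)
      ≤ ((Nat.log 2 n : ℝ) + 1) ^ 2 := by exact_mod_cast hcard
    _ ≤ δ * 2 ^ Nat.log 2 n + (K₀ + 1) ^ 2 := hbound _
    _ ≤ δ * n + (K₀ + 1) ^ 2 := by gcongr

/-! ### Dimension of families indexed by the unit interval -/

theorem dimH_univ_Ico : dimH (univ : Set (Ico (0 : ℝ) 1)) = 1 := by
  rw [← isometry_subtype_coe.dimH_image univ, image_univ, Subtype.range_coe,
    Real.dimH_of_nonempty_interior (by simp)]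
  simp

theorem dimH_univ_Ico_prod_Ico : dimH (univ : Set (Ico (0 : ℝ) 1 × Ico (0 : ℝ) 1)) = 2 := by
  have hiso : Isometry (Prod.map Subtype.val Subtype.val : Ico (0 : ℝ) 1 × Ico (0 : ℝ) 1 → ℝ × ℝ) :=
    isometry_subtype_coe.prodMap isometry_subtype_coe
  rw [← hiso.dimH_image univ, image_univ, range_prodMap, Subtype.range_coe,
    Real.dimH_of_nonempty_interior (by simp [interior_prod_eq])]
  simp

theorem ofReal_mul_le_of_forall_lt {c p : ℝ} (hp : 0 < p) {d : ℝ≥0∞}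
    (h : ∀ s, 0 < s → s < p → ENNReal.ofReal (c * s) ≤ d) : ENNReal.ofReal (c * p) ≤ d := by
  have hlim : Tendsto (fun s => ENNReal.ofReal (c * s)) (𝓝[<] p) (𝓝 (ENNReal.ofReal (c * p))) :=
    ((ENNReal.continuous_ofReal.comp (continuous_const_mul c)).tendsto p).mono_left
      nhdsWithin_le_nhds
  refine le_of_tendsto hlim ?_
  filter_upwards [Ioo_mem_nhdsLT hp] with s hs using h s hs.1 hs.2

theorem ofReal_le_dimH_range {Y : Type*} [MetricSpace Y] {p : ℝ} (hp : 0 < p)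
    {ψ : Ico (0 : ℝ) 1 → Y}
    (hψ : ∀ s, 0 < s → s < p → ∃ C, 0 ≤ C ∧ ∀ t t', dist t t' ≤ C * dist (ψ t) (ψ t') ^ s) :
    ENNReal.ofReal p ≤ dimH (range ψ) := by
  rw [← one_mul p]
  refine ofReal_mul_le_of_forall_lt hp fun s hs hsp => ?_
  obtain ⟨C, -, hC⟩ := hψ s hs hsp
  have := mul_dimH_le_dimH_image (S := univ) hs fun t _ t' _ => hC t t'
  rwa [dimH_univ_Ico, mul_one, image_univ, ← one_mul s] at this

/-- The product map on the square, of dimension 2, again has a Hölder inverse of exponent `s` in the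
maximum metric, so no product inequality for dimensions is needed. -/
theorem ofReal_two_mul_le_dimH_range_prod {Y : Type*} [MetricSpace Y] {p : ℝ} (hp : 0 < p)
    {ψ φ : Ico (0 : ℝ) 1 → Y}
    (hψ : ∀ s, 0 < s → s < p → ∃ C, 0 ≤ C ∧ ∀ t t', dist t t' ≤ C * dist (ψ t) (ψ t') ^ s)
    (hφ : ∀ s, 0 < s → s < p → ∃ C, 0 ≤ C ∧ ∀ t t', dist t t' ≤ C * dist (φ t) (φ t') ^ s) :
    ENNReal.ofReal (2 * p) ≤ dimH (range ψ ×ˢ range φ) := by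
  refine ofReal_mul_le_of_forall_lt hp fun s hs hsp => ?_
  obtain ⟨C, hC0, hC⟩ := hψ s hs hsp
  obtain ⟨C', hC0', hC'⟩ := hφ s hs hsp
  have := mul_dimH_le_dimH_image (S := univ) (ψ := Prod.map ψ φ) (C := max C C') hs
    fun t _ t' _ => by
      have h1 : dist (ψ t.1) (ψ t'.1) ≤ dist (Prod.map ψ φ t) (Prod.map ψ φ t') := le_max_left _ _
      have h2 : dist (φ t.2) (φ t'.2) ≤ dist (Prod.map ψ φ t) (Prod.map ψ φ t') := le_max_right _ _
      refine max_le ((hC t.1 t'.1).trans ?_) ((hC' t.2 t'.2).trans ?_)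
      · gcongr
        exact le_max_left _ _
      · gcongr
        exact le_max_right _ _
  rwa [dimH_univ_Ico_prod_Ico, image_univ, range_prodMap, mul_comm,
    ← ENNReal.ofReal_ofNat 2, ← ENNReal.ofReal_mul (by norm_num)] at this

/-! ### Li-Yorke pairs -/

/-- Agreement over a block of length `n + 1` forces distance at most `B / l ^ n`, and differing
symbols force distance at least `c`. -/
theorem IsExpandingSystem.isLiYorkePair {X : Type*} [MetricSpace X] {m : ℕ} [NeZero m]
    {A : Matrix (Fin m) (Fin m) ℕ} {f : X → X} {V : Fin m → Set X} {lam : Fin m → ℝ}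
    (h : IsExpandingSystem A f V lam) {a b : ℕ → Fin m} {x y : X} (hx : HasItinerary f V a x)
    (hy : HasItinerary f V b y)
    (hagree : ∀ n, ∃ᶠ N in atTop, ∀ k ≤ n, a (N + k) = b (N + k))
    (hdiff : ∃ᶠ n in atTop, a n ≠ b n) : IsLiYorkePair f x y := by
  constructor
  · obtain ⟨B, -, l, hl, hd⟩ := h.exists_dist_le
    have hlim : Tendsto (fun n : ℕ => ENNReal.ofReal (B / l ^ n)) atTop (𝓝 0) := by
      rw [← ENNReal.ofReal_zero]
      exact (ENNReal.continuous_ofReal.tendsto _).comp (tendsto_const_div_pow_atTop hl)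
    refine le_antisymm (ge_of_tendsto' hlim fun n => ?_) bot_le
    refine liminf_le_of_frequently_le' ((hagree n).mono fun N hN => ?_)
    rw [edist_dist]
    exact ENNReal.ofReal_le_ofReal (hd _ _ _ _ (hx.shift_iterate N) (hy.shift_iterate N) n hN)
  · obtain ⟨c, hc, hsep⟩ := h.separated
    refine (ENNReal.ofReal_pos.2 hc).trans_le
      (le_limsup_of_frequently_le' (hdiff.mono fun n hn => ?_))
    rw [edist_dist]
    exact ENNReal.ofReal_le_ofReal (hsep _ _ hn _ (hx n) _ (hy n))

/-! ### The cross matrix -/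

section Cross

variable {m : ℕ} [NeZero m]

theorem crossMatrix_eq_one_iff {i j : Fin m} : crossMatrix m i j = 1 ↔ i = 0 ∨ j = 0 := by
  simp [crossMatrix, or_iff_not_imp_left]

/-- The symbol 0 may stand next to every symbol, so after time `n` one may continue with 0, a free
symbol, and then zeros. -/
theorem crossMatrix_exists_ne_of_agree (hm : 2 ≤ m) {a : ℕ → Fin m}
    (ha : a ∈ subshiftSpace (crossMatrix m)) (n : ℕ) :
    ∃ b ∈ subshiftSpace (crossMatrix m), b ≠ a ∧ ∀ k ≤ n, b k = a k := by
  have hb : ∀ e : Fin m,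
      (fun k => if k ≤ n then a k else if k = n + 2 then e else 0) ∈
        subshiftSpace (crossMatrix m) := by
    intro e k
    rw [crossMatrix_eq_one_iff]
    have := crossMatrix_eq_one_iff.1 (ha k)
    rcases lt_trichotomy k n with hk | rfl | hk
    · simpa [hk.le, Nat.succ_le_of_lt hk] using this
    · simp
    · by_cases hk2 : k = n + 2
      · simp [hk2]
      · simp [hk2, hk.not_ge]
  by_cases h0 : a (n + 2) = 0
  · refine ⟨_, hb ⟨1, by omega⟩, fun e => ?_, fun k hk => by simp [hk]⟩
    have := congrFun e (n + 2)
    simp only [h0] at this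
    simp [Fin.ext_iff] at this
  · refine ⟨_, hb 0, fun e => h0 ?_, fun k hk => by simp [hk]⟩
    rw [← e]
    simp

/-- The eigenvector of the weighted cross matrix. -/
noncomputable def crossEigenvector (lam : Fin m → ℝ) (p : ℝ) (i : Fin m) : ℝ :=
  if i = 0 then 1 else lam i ^ (-p)

theorem crossEigenvector_pos {lam : Fin m → ℝ} (hlam : ∀ i, 0 < lam i) (p : ℝ) (i : Fin m) :
    0 < crossEigenvector lam p i := by
  unfold crossEigenvector
  split_ifs
  · exact one_pos
  · exact Real.rpow_pos_of_pos (hlam i) _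

/-- A row `i ≠ 0` admits only `j = 0`, which dictates `lam i ^ (-p)` once the entry at 0 is 1; row 0
is then the equation for `p` multiplied by `lam 0 ^ p`. -/
theorem sum_crossEigenvector {lam : Fin m → ℝ} (hlam : ∀ i, 0 < lam i) {p : ℝ}
    (hp : (1 / lam 0) ^ p + ∑ i ∈ Finset.univ.erase (0 : Fin m), (1 / (lam 0 * lam i)) ^ p = 1)
    (i : Fin m) :
    ∑ j with crossMatrix m i j = 1, crossEigenvector lam p j =
      lam i ^ p * crossEigenvector lam p i := by
  simp only [crossMatrix_eq_one_iff]
  have hpow : ∀ i, lam i ^ p * lam i ^ (-p) = 1 := fun i => by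
    rw [← Real.rpow_add (hlam i), add_neg_cancel, Real.rpow_zero]
  by_cases hi : i = 0
  · subst hi
    have hinv : ∀ x : ℝ, 0 < x → (1 / x) ^ p = x ^ (-p) := fun x hx => by
      rw [one_div, Real.inv_rpow hx.le, Real.rpow_neg hx.le]
    have hsum : ∑ i ∈ Finset.univ.erase (0 : Fin m), (1 / (lam 0 * lam i)) ^ p =
        lam 0 ^ (-p) * ∑ i ∈ Finset.univ.erase (0 : Fin m), crossEigenvector lam p i := by
      rw [Finset.mul_sum]
      refine Finset.sum_congr rfl fun i hi => ?_
      rw [hinv _ (mul_pos (hlam 0) (hlam i)), Real.mul_rpow (hlam 0).le (hlam i).le,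
        crossEigenvector, if_neg (Finset.ne_of_mem_erase hi)]
    rw [hsum, hinv _ (hlam 0)] at hp
    have h0 : crossEigenvector lam p 0 = 1 := if_pos rfl
    simp only [true_or, Finset.filter_true]
    rw [← Finset.add_sum_erase _ _ (Finset.mem_univ (0 : Fin m)), h0, mul_one]
    calc 1 + ∑ i ∈ Finset.univ.erase (0 : Fin m), crossEigenvector lam p i
        = (lam 0 ^ p * lam 0 ^ (-p)) *
            (1 + ∑ i ∈ Finset.univ.erase (0 : Fin m), crossEigenvector lam p i) := by
          rw [hpow, one_mul]
      _ = lam 0 ^ p * (lam 0 ^ (-p) +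
            lam 0 ^ (-p) * ∑ i ∈ Finset.univ.erase (0 : Fin m), crossEigenvector lam p i) := by
          ring
      _ = lam 0 ^ p := by rw [hp, mul_one]
  · simp only [hi, false_or, Finset.filter_eq', Finset.mem_univ, if_true, Finset.sum_singleton]
    simp [crossEigenvector, hi, hpow]

/-- This is the Moran equation of the loops at the symbol 0: the loop of length one, and those
through some `i ≠ 0`. -/
theorem exists_unique_cross_exponent (hm : 2 ≤ m) {lam : Fin m → ℝ} (hlam : ∀ i, 1 < lam i) :
    ∃ p₀ : ℝ, 0 < p₀ ∧ ∀ p : ℝ, (1 / lam 0) ^ p +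
      ∑ i ∈ Finset.univ.erase (0 : Fin m), (1 / (lam 0 * lam i)) ^ p = 1 ↔ p = p₀ := by
  have hpos : ∀ i, 0 < lam i := fun i => one_pos.trans (hlam i)
  obtain ⟨p₀, hp₀, h⟩ := exists_unique_moran_exponent (ι := Fin m) (by rw [Fintype.card_fin]; omega)
    (fun i => if i = 0 then 1 / lam 0 else 1 / (lam 0 * lam i))
    (fun i => by have := hpos 0; have := hpos i; split_ifs <;> positivity)
    (fun i => by
      have h0 := hlam 0
      have hi := hlam i
      split_ifs
      · rw [div_lt_one (hpos 0)]; exact h0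
      · rw [div_lt_one (mul_pos (hpos 0) (hpos i))]; nlinarith)
  refine ⟨p₀, hp₀, fun p => ?_⟩
  rw [← h p, ← Finset.add_sum_erase _ _ (Finset.mem_univ (0 : Fin m)), if_pos rfl]
  have hsum : ∑ i ∈ Finset.univ.erase (0 : Fin m), (1 / (lam 0 * lam i)) ^ p =
      ∑ i ∈ Finset.univ.erase (0 : Fin m),
        (if i = 0 then 1 / lam 0 else 1 / (lam 0 * lam i)) ^ p :=
    Finset.sum_congr rfl fun i hi => by rw [if_neg (Finset.ne_of_mem_erase hi)]
  rw [hsum]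

variable {X : Type*} [MetricSpace X] {f : X → X} {V : Fin m → Set X} {lam : Fin m → ℝ}

theorem IsExpandingSystem.isCantorSet_codedSet (h : IsExpandingSystem (crossMatrix m) f V lam)
    (hm : 2 ≤ m) : IsCantorSet (codedSet (crossMatrix m) f V) where
  nonempty := ⟨_, h.point_mem ⟨fun _ => 0, fun _ => crossMatrix_eq_one_iff.2 (Or.inl rfl)⟩⟩
  isCompact := h.isCompact_codedSet
  perfect := ⟨h.isCompact_codedSet.isClosed,
    h.preperfect_codedSet fun _ ha n => crossMatrix_exists_ne_of_agree hm ha n⟩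
  isTotallyDisconnected := h.isTotallyDisconnected_codedSet

/-- Two families of coded points of full dimension, any two members of which form a Li-Yorke
pair. -/
theorem IsExpandingSystem.exists_liYorke_families
    (h : IsExpandingSystem (crossMatrix m) f V lam) (hm : 2 ≤ m) {p : ℝ}
    (hp : (1 / lam 0) ^ p + ∑ i ∈ Finset.univ.erase (0 : Fin m), (1 / (lam 0 * lam i)) ^ p = 1) :
    ∃ ψ φ : Ico (0 : ℝ) 1 → X, range ψ ⊆ codedSet (crossMatrix m) f V ∧
      range ψ ×ˢ range φ ⊆ liYorkePairs f (codedSet (crossMatrix m) f V) ∧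
      (∀ s, 0 < s → s < p → ∃ C, 0 ≤ C ∧ ∀ t t', dist t t' ≤ C * dist (ψ t) (ψ t') ^ s) ∧
      ∀ s, 0 < s → s < p → ∃ C, 0 ≤ C ∧ ∀ t t', dist t t' ≤ C * dist (φ t) (φ t') ^ s := by
  have hv := crossEigenvector_pos h.lam_pos p
  have heig := sum_crossEigenvector h.lam_pos hp
  let e : Fin m := ⟨1, by omega⟩
  have he : e ≠ 0 := by simp [e, Fin.ext_iff]
  obtain ⟨a, ψ, haA, hψ, hau, hψd⟩ := h.exists_forced_family hv heig isSparse_dyadicWindows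
    -- Zeros throughout each window except at its last time, where `e` is requested; the other
    -- family requests 0 there too.
    fun n => if n = 2 ^ Nat.log 2 n + Nat.log 2 n then e else 0
  obtain ⟨b, φ, hbA, hφ, hbu, hφd⟩ := h.exists_forced_family hv heig isSparse_dyadicWindows
    fun _ => 0
  have hψmem : ∀ t, ψ t ∈ codedSet (crossMatrix m) f V := fun t =>
    mem_codedSet.2 ⟨a t, haA t, hψ t⟩
  have hb0 : ∀ t k i, i ≤ k → b t (2 ^ k + i + 1) = 0 := fun t k i hik =>
    hbu t _ (two_pow_add_mem_dyadicWindows hik) (crossMatrix_eq_one_iff.2 (Or.inr rfl))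
  have ha0 : ∀ t k i, i < k → a t (2 ^ k + i + 1) = 0 := fun t k i hik => by
    have hne : 2 ^ k + i ≠ 2 ^ Nat.log 2 (2 ^ k + i) + Nat.log 2 (2 ^ k + i) := by
      rw [log_two_pow_add hik.le]
      omega
    have := hau t _ (two_pow_add_mem_dyadicWindows hik.le)
    rw [if_neg hne] at this
    exact this (crossMatrix_eq_one_iff.2 (Or.inr rfl))
  -- The symbol `e` can be forced only after a 0, which the preceding time of the same window
  -- supplies; this needs `0 < k`.
  have hae : ∀ t k, 0 < k → a t (2 ^ k + k + 1) = e := fun t k hk => by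
    have heq : 2 ^ k + k = 2 ^ Nat.log 2 (2 ^ k + k) + Nat.log 2 (2 ^ k + k) := by
      rw [log_two_pow_add le_rfl]
    have := hau t _ (two_pow_add_mem_dyadicWindows (le_refl k))
    rw [if_pos heq] at this
    refine this (crossMatrix_eq_one_iff.2 (Or.inl ?_))
    have := ha0 t k (k - 1) (by omega)
    rwa [add_assoc, Nat.sub_add_cancel hk] at this
  refine ⟨ψ, φ, range_subset_iff.2 hψmem, ?_, hψd, hφd⟩
  rintro ⟨x, y⟩ ⟨⟨t, rfl⟩, ⟨t', rfl⟩⟩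
  refine ⟨hψmem t, mem_codedSet.2 ⟨b t', hbA t', hφ t'⟩,
    h.isLiYorkePair (hψ t) (hφ t') (fun n => ?_) ?_⟩
  -- The window of index `N + n + 1` starts after `N` and has more than `n` forced common zeros; the
  -- 1 is the delay between forcing and symbol.
  · refine frequently_atTop.2 fun N => ⟨2 ^ (N + n + 1) + 1, ?_, fun k hk => ?_⟩
    · have := Nat.lt_two_pow_self (n := N + n + 1)
      omega
    · rw [add_right_comm, ha0 t _ k (by omega), hb0 t' _ k (by omega)]
  · refine frequently_atTop.2 fun N => ⟨2 ^ (N + 1) + (N + 1) + 1, by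
      have := Nat.lt_two_pow_self (n := N + 1)
      omega, ?_⟩
    rw [hae t _ N.succ_pos, hb0 t' _ _ le_rfl]
    exact he

end Cross

/-! ### From strict coupled expansion to the theorem -/

theorem IsStrictlyCoupledExpanding.isExpandingSystem {X : Type*} [MetricSpace X] {m : ℕ}
    {A : Matrix (Fin m) (Fin m) ℕ} {f : X → X} {D : Set X} {V : Fin m → Set X} {lam : Fin m → ℝ}
    (hexp : IsStrictlyCoupledExpanding A f D V) (hV : ∀ i, IsCompact (V i))
    (hlam : ∀ i, 1 < lam i)
    (hratio : ∀ i, ∀ x ∈ V i, ∀ y ∈ V i, dist (f x) (f y) = lam i * dist x y) :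
    IsExpandingSystem A f V lam where
  isCompact := hV
  nonempty := hexp.nonempty
  one_lt := hlam
  dist_eq := hratio
  covers i j hij := (subset_iUnion₂ (s := fun j (_ : A i j = 1) => V j) j hij).trans (hexp.covers i)
  separated := by
    -- Each pair admits all sufficiently small positive `c`, and there are finitely many pairs.
    have hev : ∀ᶠ c in 𝓝[>] (0 : ℝ), ∀ i j, i ≠ j → ∀ x ∈ V i, ∀ y ∈ V j, c ≤ dist x y := by
      simp only [eventually_all]
      intro i j hij
      obtain ⟨c, hc0, hc⟩ := ENNReal.lt_iff_exists_nnreal_btwn.1 (hexp.dist_pos i j hij)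
      filter_upwards [Ioo_mem_nhdsGT (NNReal.coe_pos.2 (ENNReal.coe_pos.1 hc0))] with r hr x hx y hy
      have hle : (c : ℝ≥0∞) ≤ edist x y :=
        hc.le.trans ((iInf₂_le x hx).trans (iInf₂_le y hy))
      rw [edist_nndist, ENNReal.coe_le_coe] at hle
      exact hr.2.le.trans hle
    obtain ⟨c, hc, hc0⟩ := (hev.and self_mem_nhdsWithin).exists
    exact ⟨c, hc0, hc⟩

theorem theorem4p2 {X : Type*} [MetricSpace X] (m : ℕ) [NeZero m] (hm : 2 ≤ m)
    (D : Set X) (f : X → X) (hf : ContinuousOn f D)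
    (V : Fin m → Set X) (hV : ∀ i, IsCompact (V i))
    (hdisj : ∀ i j, i ≠ j → Disjoint (V i) (V j))
    (hexp : IsStrictlyCoupledExpanding (crossMatrix m) f D V)
    (lam : Fin m → ℝ) (hlam : ∀ i, 1 < lam i)
    (hratio : ∀ i, ∀ x ∈ V i, ∀ y ∈ V i, dist (f x) (f y) = lam i * dist x y) :
    (codedSet (crossMatrix m) f V ⊆ ⋃ i, V i) ∧
    f '' codedSet (crossMatrix m) f V = codedSet (crossMatrix m) f V ∧
    IsCantorSet (codedSet (crossMatrix m) f V) ∧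
    (∃ g : subshiftSpace (crossMatrix m) ≃ₜ codedSet (crossMatrix m) f V,
      (∀ a, f (g a) = g (subshift (crossMatrix m) a)) ∧
      ∀ a, (g a : X) ∈ V (a.1 0)) ∧
    ∃ p₀ : ℝ, 0 < p₀ ∧
      (∀ p : ℝ, (1 / lam 0) ^ p + ∑ i ∈ Finset.univ.erase (0 : Fin m), (1 / (lam 0 * lam i)) ^ p = 1
        ↔ p = p₀) ∧
      dimH (codedSet (crossMatrix m) f V) = ENNReal.ofReal p₀ ∧
      dimH (liYorkePairs f (codedSet (crossMatrix m) f V)) = ENNReal.ofReal (2 * p₀) := by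
  have h := hexp.isExpandingSystem hV hlam hratio
  refine ⟨codedSet_subset _ f V,
    h.image_codedSet fun j => ⟨0, crossMatrix_eq_one_iff.2 (Or.inl rfl)⟩,
    h.isCantorSet_codedSet hm,
    ⟨h.coding, h.map_point, fun a => h.hasItinerary_point a 0⟩, ?_⟩
  obtain ⟨p₀, hp₀, hroot⟩ := exists_unique_cross_exponent hm hlam
  have hp := (hroot p₀).2 rfl
  obtain ⟨C, r₀, hr₀, hcov⟩ := h.exists_isCoverable hp₀.le (crossEigenvector_pos h.lam_pos p₀)
    (sum_crossEigenvector h.lam_pos hp)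
  obtain ⟨ψ, φ, hψ, hLY, hψd, hφd⟩ := h.exists_liYorke_families hm hp
  refine ⟨p₀, hp₀, hroot, le_antisymm (dimH_le_of_isCoverable hr₀ hp₀.le hcov) ?_,
    le_antisymm ?_ ?_⟩
  · exact (ofReal_le_dimH_range hp₀ hψd).trans (dimH_mono hψ)
  · refine (dimH_mono ?_).trans (dimH_prod_self_le_of_isCoverable hr₀ hp₀.le hcov)
    exact fun z hz => ⟨hz.1, hz.2.1⟩
  · exact (ofReal_two_mul_le_dimH_range_prod hp₀ hψd hφd).trans (dimH_mono hLY)
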